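/- Let $N\ge 2$, $0<s<1$, and let $m$ be a real function, continuously differentiable on $(0,\infty)$. Put $M(t)=\int_0^{|t|}m(\tau)\tau\,d\tau$ and assume: * $m(t)>0$ and $(m(t)t)'>0$ for all $t>0$; * there are $l,r\in(1,N)$ with $l\le r<\frac{Nl}{N-l}$ and $l\le \frac{m(t)t^2}{M(t)}\le r$ for all $t>0$; * the function $t\mapsto M(\sqrt t)$ is convex on $[0,\infty)$; * $V:\mathbb R^N\to\mathbb R$ is continuous and $V\ge V_0$ on $\mathbb R^N$ for some constant $V_0>0$. Let $M^{-1}$ be the inverse of $M$ on $[0,\infty)$, and for measurable $u:\mathbb R^N\to\mathbb R$ let $$h_u(x,y)=\frac{u(x)-u(y)}{|x-y|^{s}M^{-1}(|x-y|^{N})}.$$ Let $E$ be the space of (a.e. classes of) measurable functions $u$ on $\mathbb R^N$ such that $\int_{\mathbb R^N}M(\lambda u)\,dx<\infty$ for some $\lambda>0$, $\int_{\mathbb R^N}\int_{\mathbb R^N}M(\lambda h_u)\,dx\,dy<\infty$ for some $\lambda>0$, and $\int_{\mathbb R^N}V(x)M(u)\,dx<\infty$, with the norm $\|u\|=[u]_{(s,M)}+\|u\|_{(V,M)}$,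 where $$[u]_{(s,M)}=\inf\Big\{\lambda>0:\int_{\mathbb R^N}\int_{\mathbb R^N} M\Big(\frac{h_u}{\lambda}\Big)dx\,dy\le 1\Big\},\qquad \|u\|_{(V,M)}=\inf\Big\{\lambda>0:\int_{\mathbb R^N} V(x)M\Big(\frac u\lambda\Big)dx\le 1\Big\}.$$ Let $A:E\to\mathbb R$, $A=G+\Psi$, where $G(u)=\int_{\mathbb R^N}\int_{\mathbb R^N}M(h_u(x,y))\,dx\,dy$ and $\Psi(u)=\int_{\mathbb R^N}V(x)M(u)\,dx$, and let $A'$ denote the Fréchet derivative of $A$. If $u_n\rightharpoonup u$ weakly in $E$ and $\langle A'(u_n),u_n-u\rangle\to 0$, then $u_n\to u$ strongly in $E$. -/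

import Mathlib

open MeasureTheory Set Filter Topology
open scoped ENNReal

noncomputable section

namespace FracOrlicz

/-- The Euclidean space `ℝ^N`. -/
abbrev Rn (N : ℕ) : Type := EuclideanSpace ℝ (Fin N)

/-- `M(t) = ∫₀^{|t|} m(τ) τ dτ`. -/
def orliczM (m : ℝ → ℝ) (t : ℝ) : ℝ := ∫ τ in (0 : ℝ)..|t|, m τ * τ

/-- `M⁻¹`, the inverse of `M` restricted to `[0,∞)`. -/
def orliczInv (m : ℝ → ℝ) : ℝ → ℝ := Function.invFunOn (orliczM m) (Ici 0)

/-- The modular `∫ M(f) dμ`, with values in `[0,∞]`. -/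
def modular {Y : Type*} [MeasurableSpace Y] (M : ℝ → ℝ) (μ : Measure Y) (f : Y → ℝ) : ℝ≥0∞ :=
  ∫⁻ y, ENNReal.ofReal (M (f y)) ∂μ

/-- The Luxemburg norm `inf {c > 0 : ∫ M(f / c) dμ ≤ 1}`. -/
def luxemburg {Y : Type*} [MeasurableSpace Y] (M : ℝ → ℝ) (μ : Measure Y) (f : Y → ℝ) : ℝ :=
  sInf {c : ℝ | 0 < c ∧ modular M μ (fun y => f y / c) ≤ 1}

/-- `h_u(x,y) = (u(x) - u(y)) / (|x-y|^s M⁻¹(|x-y|^N))`. -/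
def diffQuot {N : ℕ} (s : ℝ) (m : ℝ → ℝ) (u : Rn N → ℝ) (p : Rn N × Rn N) : ℝ :=
  (u p.1 - u p.2) / (‖p.1 - p.2‖ ^ s * orliczInv m (‖p.1 - p.2‖ ^ N))

/-- The measure `V(x) dx` on `ℝ^N`. -/
def weighted {N : ℕ} (V : Rn N → ℝ) : Measure (Rn N) :=
  (volume : Measure (Rn N)).withDensity (fun x => ENNReal.ofReal (V x))

/-- The Orlicz space `L^M(ℝ^N)`. -/
def orliczSpace (N : ℕ) (m : ℝ → ℝ) : Set (Rn N →ₘ[volume] ℝ) :=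
  {u | ∃ c : ℝ, 0 < c ∧ modular (orliczM m) volume (fun x => c * u x) < ∞}

/-- The fractional Orlicz-Sobolev space `W^{s,M}(ℝ^N)`. -/
def fracOrliczSobolev (N : ℕ) (s : ℝ) (m : ℝ → ℝ) : Set (Rn N →ₘ[volume] ℝ) :=
  {u | u ∈ orliczSpace N m ∧ ∃ c : ℝ, 0 < c ∧
    modular (orliczM m) ((volume : Measure (Rn N)).prod volume)
      (fun p => c * diffQuot s m u p) < ∞}

/-- The carrier of `E`: those `u ∈ W^{s,M}(ℝ^N)` with `∫ V(x) M(u(x)) dx < ∞`. -/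
def carrierE {N : ℕ} (s : ℝ) (m : ℝ → ℝ) (V : Rn N → ℝ) : Set (Rn N →ₘ[volume] ℝ) :=
  {u | u ∈ fracOrliczSobolev N s m ∧ modular (orliczM m) (weighted V) u < ∞}

/-- The assumptions under which the space `E` is built. The continuous differentiability of `m`
is only required on `(0,∞)`. -/
structure Admissible (N : ℕ) (s : ℝ) (m : ℝ → ℝ) (V : Rn N → ℝ) : Prop where
  two_le : 2 ≤ N
  s_pos : 0 < s
  s_lt_one : s < 1
  contDiff : ContDiffOn ℝ 1 m (Ioi 0)
  m_pos : ∀ t : ℝ, 0 < t → 0 < m t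
  deriv_pos : ∀ t : ℝ, 0 < t → 0 < deriv (fun τ => m τ * τ) t
  growth : ∃ l r : ℝ, 1 < l ∧ l < N ∧ 1 < r ∧ r < N ∧ l ≤ r ∧ r < N * l / (N - l) ∧
    ∀ t : ℝ, 0 < t → l ≤ m t * t ^ 2 / orliczM m t ∧ m t * t ^ 2 / orliczM m t ≤ r
  V_cont : Continuous V
  V_bound : ∃ V₀ : ℝ, 0 < V₀ ∧ ∀ x, V₀ ≤ V x

/-! ### Facts needed to see that `E` is a normed space -/

/-- The properties of `M` used to build `E` (all of them are proved below for `orliczM m`). -/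
structure Nice (M : ℝ → ℝ) : Prop where
  even : ∀ t, M (-t) = M t
  zero : M 0 = 0
  pos : ∀ t, t ≠ 0 → 0 < M t
  conv : ConvexOn ℝ univ M
  scale : ∀ k : ℝ, ∃ K : ℝ, 0 ≤ K ∧ ∀ t, M (k * t) ≤ K * M t

theorem Nice.nonneg {M : ℝ → ℝ} (h : Nice M) (t : ℝ) : 0 ≤ M t := by
  rcases eq_or_ne t 0 with rfl | ht
  · exact h.zero.ge
  · exact (h.pos t ht).le

theorem Nice.continuous {M : ℝ → ℝ} (h : Nice M) : Continuous M := by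
  have := h.conv.continuousOn isOpen_univ
  exact continuousOn_univ.mp this

theorem Nice.shrink {M : ℝ → ℝ} (h : Nice M) {a : ℝ} (ha0 : 0 ≤ a) (ha1 : a ≤ 1) (t : ℝ) :
    M (a * t) ≤ a * M t := by
  have := h.conv.2 (mem_univ t) (mem_univ 0) ha0 (sub_nonneg.2 ha1) (by ring)
  simpa [h.zero] using this

section Modular

variable {Y : Type*} [MeasurableSpace Y] {M : ℝ → ℝ} {μ : Measure Y} {f g : Y → ℝ}

theorem modular_congr (hfg : f =ᵐ[μ] g) : modular M μ f = modular M μ g := by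
  refine lintegral_congr_ae ?_
  filter_upwards [hfg] with y hy
  rw [hy]

theorem luxemburg_congr (hfg : f =ᵐ[μ] g) : luxemburg M μ f = luxemburg M μ g := by
  unfold luxemburg
  congr 1
  ext c
  have : modular M μ (fun y => f y / c) = modular M μ (fun y => g y / c) := by
    refine modular_congr ?_
    filter_upwards [hfg] with y hy
    rw [hy]
  simp only [mem_ofPred_eq, this]

theorem modular_le_mul {K : ℝ} (hK : 0 ≤ K) (hfg : ∀ y, M (f y) ≤ K * M (g y)) :
    modular M μ f ≤ ENNReal.ofReal K * modular M μ g := by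
  unfold modular
  rw [← lintegral_const_mul' _ _ ENNReal.ofReal_ne_top]
  refine lintegral_mono fun y => ?_
  rw [← ENNReal.ofReal_mul hK]
  exact ENNReal.ofReal_le_ofReal (hfg y)

theorem Nice.modular_smul_lt (h : Nice M) (k : ℝ) (hf : modular M μ f < ∞) :
    modular M μ (fun y => k * f y) < ∞ := by
  obtain ⟨K, hK, hs⟩ := h.scale k
  exact (modular_le_mul hK fun y => hs (f y)).trans_lt
    (ENNReal.mul_lt_top ENNReal.ofReal_lt_top hf)

theorem Nice.modular_convex (h : Nice M) (hf : AEMeasurable f μ) {a b : ℝ}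
    (ha : 0 ≤ a) (hb : 0 ≤ b) (hab : a + b = 1) :
    modular M μ (fun y => a * f y + b * g y) ≤
      ENNReal.ofReal a * modular M μ f + ENNReal.ofReal b * modular M μ g := by
  unfold modular
  rw [← lintegral_const_mul' _ _ ENNReal.ofReal_ne_top,
    ← lintegral_const_mul' _ _ ENNReal.ofReal_ne_top, ← lintegral_add_left']
  · refine lintegral_mono fun y => ?_
    rw [← ENNReal.ofReal_mul ha, ← ENNReal.ofReal_mul hb, ← ENNReal.ofReal_add
      (mul_nonneg ha (h.nonneg _)) (mul_nonneg hb (h.nonneg _))]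
    refine ENNReal.ofReal_le_ofReal ?_
    simpa using h.conv.2 (mem_univ (f y)) (mem_univ (g y)) ha hb hab
  · exact ((h.continuous.measurable.comp_aemeasurable hf).ennreal_ofReal).const_mul _

theorem Nice.modular_add_lt (h : Nice M) (hm : AEMeasurable f μ)
    (hf : modular M μ f < ∞) (hg : modular M μ g < ∞) :
    modular M μ (fun y => f y + g y) < ∞ := by
  have h1 := h.modular_convex (f := f) (g := g) hm (a := 1 / 2) (b := 1 / 2)
    (by norm_num) (by norm_num) (by norm_num)
  have h2 := h.modular_smul_lt 2 (h1.trans_lt (ENNReal.add_lt_top.2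
    ⟨ENNReal.mul_lt_top ENNReal.ofReal_lt_top hf, ENNReal.mul_lt_top ENNReal.ofReal_lt_top hg⟩))
  convert h2 using 3
  ring

theorem Nice.exists_iff (h : Nice M) :
    (∃ c : ℝ, 0 < c ∧ modular M μ (fun y => c * f y) < ∞) ↔ modular M μ f < ∞ := by
  constructor
  · rintro ⟨c, hc, hf⟩
    have := h.modular_smul_lt c⁻¹ hf
    convert this using 3
    field_simp
  · intro hf
    exact ⟨1, one_pos, by simpa using hf⟩

theorem Nice.luxSet_nonempty (h : Nice M) (hf : modular M μ f < ∞) :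
    {c : ℝ | 0 < c ∧ modular M μ (fun y => f y / c) ≤ 1}.Nonempty := by
  set k : ℝ := (modular M μ f).toReal + 1 with hk
  have hk1 : 1 ≤ k := by simp [hk]
  have hk0 : 0 < k := by linarith
  refine ⟨k, hk0, ?_⟩
  have h1 : modular M μ (fun y => f y / k) ≤ ENNReal.ofReal k⁻¹ * modular M μ f := by
    refine modular_le_mul (by positivity) fun y => ?_
    rw [div_eq_inv_mul]
    exact h.shrink (by positivity) (inv_le_one_of_one_le₀ hk1) _
  refine h1.trans ?_
  rw [← ENNReal.ofReal_toReal hf.ne, ← ENNReal.ofReal_mul (by positivity)]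
  refine ENNReal.ofReal_le_one.2 ?_
  rw [inv_mul_le_iff₀ hk0]
  linarith

theorem luxSet_bddBelow :
    BddBelow {c : ℝ | 0 < c ∧ modular M μ (fun y => f y / c) ≤ 1} :=
  ⟨0, fun _ hc => hc.1.le⟩

theorem luxemburg_nonneg : 0 ≤ luxemburg M μ f :=
  Real.sInf_nonneg fun _ hc => hc.1.le

theorem Nice.luxemburg_add_le (h : Nice M) (hm : AEMeasurable f μ)
    (hf : modular M μ f < ∞) (hg : modular M μ g < ∞) :
    luxemburg M μ (fun y => f y + g y) ≤ luxemburg M μ f + luxemburg M μ g := by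
  have key : ∀ a ∈ {c : ℝ | 0 < c ∧ modular M μ (fun y => f y / c) ≤ 1},
      ∀ b ∈ {c : ℝ | 0 < c ∧ modular M μ (fun y => g y / c) ≤ 1},
      luxemburg M μ (fun y => f y + g y) ≤ a + b := by
    rintro a ⟨ha, hfa⟩ b ⟨hb, hgb⟩
    refine csInf_le luxSet_bddBelow ⟨by positivity, ?_⟩
    have hab : a / (a + b) + b / (a + b) = 1 := by field_simp
    have h1 := h.modular_convex (μ := μ) (f := fun y => f y / a) (g := fun y => g y / b)
      (hm.div_const a) (a := a / (a + b)) (b := b / (a + b))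
      (by positivity) (by positivity) hab
    have h2 : (fun y => (f y + g y) / (a + b)) =
        fun y => a / (a + b) * (f y / a) + b / (a + b) * (g y / b) := by
      funext y
      field_simp
    rw [h2]
    refine h1.trans ?_
    calc _ ≤ ENNReal.ofReal (a / (a + b)) * 1 + ENNReal.ofReal (b / (a + b)) * 1 := by gcongr
      _ = 1 := by
        rw [mul_one, mul_one, ← ENNReal.ofReal_add (by positivity) (by positivity), hab,
          ENNReal.ofReal_one]
  have h3 : luxemburg M μ (fun y => f y + g y) - luxemburg M μ g ≤ luxemburg M μ f := by
    refine le_csInf (h.luxSet_nonempty hf) fun a ha => ?_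
    have : luxemburg M μ (fun y => f y + g y) - a ≤ luxemburg M μ g :=
      le_csInf (h.luxSet_nonempty hg) fun b hb => by linarith [key a ha b hb]
    linarith
  linarith

theorem Nice.luxemburg_zero (h : Nice M) : luxemburg M μ (fun _ => (0 : ℝ)) = 0 := by
  refine le_antisymm (le_of_forall_pos_le_add fun ε hε => ?_) luxemburg_nonneg
  refine (csInf_le luxSet_bddBelow ⟨hε, ?_⟩).trans (by simp)
  simp [modular, h.zero]

theorem Nice.luxemburg_smul_le (h : Nice M) {k : ℝ} (hk : k ≠ 0) (hf : modular M μ f < ∞) :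
    luxemburg M μ (fun y => k * f y) ≤ |k| * luxemburg M μ f := by
  have hk' : 0 < |k| := abs_pos.2 hk
  rw [← div_le_iff₀' hk']
  refine le_csInf (h.luxSet_nonempty hf) ?_
  rintro a ⟨ha, hfa⟩
  rw [div_le_iff₀' hk']
  refine csInf_le luxSet_bddBelow ⟨by positivity, ?_⟩
  refine le_trans (le_of_eq ?_) hfa
  unfold modular
  refine lintegral_congr fun y => ?_
  congr 1
  rcases abs_cases k with ⟨hka, _⟩ | ⟨hka, _⟩
  · rw [hka]
    congr 1
    field_simp
  · rw [hka, ← h.even]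
    congr 1
    field_simp

theorem Nice.luxemburg_smul (h : Nice M) (k : ℝ) (hf : modular M μ f < ∞) :
    luxemburg M μ (fun y => k * f y) = |k| * luxemburg M μ f := by
  rcases eq_or_ne k 0 with rfl | hk
  · simp [h.luxemburg_zero]
  refine le_antisymm (h.luxemburg_smul_le hk hf) ?_
  have h1 := h.luxemburg_smul_le (inv_ne_zero hk) (h.modular_smul_lt k hf)
  have h2 : (fun y => k⁻¹ * (k * f y)) = f := by
    funext y
    field_simp
  rw [h2, abs_inv] at h1
  rwa [← le_inv_mul_iff₀ (abs_pos.2 hk)]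

theorem Nice.ae_eq_zero (h : Nice M) (hm : AEMeasurable f μ) (hf : modular M μ f < ∞)
    (h0 : luxemburg M μ f = 0) : f =ᵐ[μ] fun _ => 0 := by
  have key : ∀ ε : ℝ, 0 < ε → ε ≤ 1 → modular M μ f ≤ ENNReal.ofReal ε := by
    intro ε hε hε1
    obtain ⟨a, ⟨ha, hfa⟩, haε⟩ := exists_lt_of_csInf_lt (h.luxSet_nonempty hf)
      (show luxemburg M μ f < ε by rw [h0]; exact hε)
    have h1 : modular M μ f ≤ ENNReal.ofReal a * modular M μ (fun y => f y / a) := by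
      refine modular_le_mul ha.le fun y => ?_
      have := h.shrink ha.le (by linarith) (f y / a)
      rwa [mul_div_cancel₀ _ ha.ne'] at this
    calc _ ≤ ENNReal.ofReal a * modular M μ (fun y => f y / a) := h1
      _ ≤ ENNReal.ofReal ε * 1 := by gcongr
      _ = _ := mul_one _
  have hzero : modular M μ f = 0 := by
    by_contra hne
    have hpos : 0 < (modular M μ f).toReal := ENNReal.toReal_pos hne hf.ne
    have h2 := key (min 1 ((modular M μ f).toReal / 2)) (by positivity) (min_le_left _ _)
    have h3 := ENNReal.toReal_le_of_le_ofReal (by positivity) h2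
    have h4 := min_le_right 1 ((modular M μ f).toReal / 2)
    linarith
  unfold modular at hzero
  have hmeas : AEMeasurable (fun y => ENNReal.ofReal (M (f y))) μ :=
    (h.continuous.measurable.comp_aemeasurable hm).ennreal_ofReal
  rw [lintegral_eq_zero_iff' hmeas] at hzero
  filter_upwards [hzero] with y hy
  by_contra hne
  have := h.pos _ hne
  simp only [Pi.zero_apply, ENNReal.ofReal_eq_zero] at hy
  linarith

end Modular

namespace Admissible

variable {N : ℕ} {s : ℝ} {m : ℝ → ℝ} {V : Rn N → ℝ}

theorem contOn (h : Admissible N s m V) : ContinuousOn (fun τ => m τ * τ) (Ioi 0) :=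
  h.contDiff.continuousOn.mul continuousOn_id

theorem strictMonoOn (h : Admissible N s m V) : StrictMonoOn (fun τ => m τ * τ) (Ici 0) := by
  have h1 : StrictMonoOn (fun τ => m τ * τ) (Ioi 0) :=
    strictMonoOn_of_deriv_pos (convex_Ioi 0) h.contOn
      (by rw [interior_Ioi]; exact fun x hx => h.deriv_pos x hx)
  intro a ha b hb hab
  rcases eq_or_lt_of_le (show (0 : ℝ) ≤ a from ha) with rfl | ha'
  · have := mul_pos (h.m_pos b hab) hab
    simpa using this
  · exact h1 ha' (ha'.trans hab) hab

theorem intervalIntegrable (h : Admissible N s m V) {a b : ℝ} (ha : 0 ≤ a) (hb : 0 ≤ b) :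
    IntervalIntegrable (fun τ => m τ * τ) volume a b := by
  refine (h.strictMonoOn.monotoneOn.mono ?_).intervalIntegrable
  intro x hx
  exact (le_min ha hb).trans hx.1

theorem hasDerivAt (h : Admissible N s m V) {t : ℝ} (ht : 0 < t) :
    HasDerivAt (orliczM m) (m t * t) t := by
  have hc : ContinuousAt (fun τ => m τ * τ) t := h.contOn.continuousAt (Ioi_mem_nhds ht)
  have h1 : HasDerivAt (fun x => ∫ τ in (0 : ℝ)..x, m τ * τ) (m t * t) t := by
    refine intervalIntegral.integral_hasDerivAt_right (h.intervalIntegrable le_rfl ht.le) ?_ hc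
    exact h.contOn.stronglyMeasurableAtFilter isOpen_Ioi t ht
  refine h1.congr_of_eventuallyEq ?_
  filter_upwards [Ioi_mem_nhds ht] with x hx
  simp [orliczM, abs_of_pos (show (0 : ℝ) < x from hx)]

theorem M_zero : orliczM m 0 = 0 := by simp [orliczM]

theorem M_pos (h : Admissible N s m V) {t : ℝ} (ht : t ≠ 0) : 0 < orliczM m t := by
  have ht' : 0 < |t| := abs_pos.2 ht
  refine intervalIntegral.intervalIntegral_pos_of_pos_on
    (h.intervalIntegrable le_rfl ht'.le) ?_ ht'
  exact fun x hx => mul_pos (h.m_pos x hx.1) hx.1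

theorem continuousOn_M (h : Admissible N s m V) : ContinuousOn (orliczM m) (Ici 0) := by
  intro t ht
  have hi : IntegrableOn (fun τ => m τ * τ) (uIcc 0 (t + 1)) := by
    have ht0 : (0 : ℝ) ≤ t + 1 := by linarith [show (0 : ℝ) ≤ t from ht]
    rw [uIcc_of_le ht0, ← intervalIntegrable_iff_integrableOn_Icc_of_le ht0]
    exact h.intervalIntegrable le_rfl ht0
  have h1 := intervalIntegral.continuousOn_primitive_interval hi
  have ht0 : (0 : ℝ) ≤ t := ht
  rw [uIcc_of_le (by linarith)] at h1
  have h2 : ContinuousWithinAt (fun x => ∫ τ in (0 : ℝ)..x, m τ * τ) (Ici 0) t := by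
    refine (h1 t ⟨ht0, by linarith⟩).mono_of_mem_nhdsWithin ?_
    rw [mem_nhdsWithin]
    exact ⟨Iio (t + 1), isOpen_Iio, by simp, fun x hx => ⟨hx.2, hx.1.le⟩⟩
  refine h2.congr (fun x hx => ?_) ?_
  · simp [orliczM, abs_of_nonneg (show (0 : ℝ) ≤ x from hx)]
  · simp [orliczM, abs_of_nonneg ht0]

theorem strictMonoOn_M (h : Admissible N s m V) : StrictMonoOn (orliczM m) (Ici 0) := by
  refine strictMonoOn_of_deriv_pos (convex_Ici 0) h.continuousOn_M ?_
  rw [interior_Ici]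
  intro t ht
  rw [(h.hasDerivAt ht).deriv]
  exact mul_pos (h.m_pos t ht) ht

theorem convexOn_M (h : Admissible N s m V) : ConvexOn ℝ univ (orliczM m) := by
  have h1 : ConvexOn ℝ (Ici 0) (orliczM m) := by
    refine MonotoneOn.convexOn_of_deriv (convex_Ici 0) h.continuousOn_M ?_ ?_
    · rw [interior_Ici]
      exact fun t ht => (h.hasDerivAt ht).differentiableAt.differentiableWithinAt
    · rw [interior_Ici]
      intro a ha b hb hab
      rw [(h.hasDerivAt ha).deriv, (h.hasDerivAt hb).deriv]
      exact h.strictMonoOn.monotoneOn (mem_Ici_of_Ioi ha) (mem_Ici_of_Ioi hb) hab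
  refine ⟨convex_univ, fun x _ y _ a b ha hb hab => ?_⟩
  have habs : ∀ t, orliczM m |t| = orliczM m t := fun t => by simp [orliczM]
  rw [← habs, ← habs x, ← habs y]
  refine le_trans ?_ (h1.2 (abs_nonneg x) (abs_nonneg y) ha hb hab)
  refine h.strictMonoOn_M.monotoneOn (mem_Ici.2 (abs_nonneg _)) ?_ ?_
  · simp only [smul_eq_mul, mem_Ici]
    positivity
  · simp only [smul_eq_mul]
    refine (abs_add_le _ _).trans_eq ?_
    rw [abs_mul, abs_mul, abs_of_nonneg ha, abs_of_nonneg hb]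

theorem scale_M (h : Admissible N s m V) (k : ℝ) :
    ∃ K : ℝ, 0 ≤ K ∧ ∀ t, orliczM m (k * t) ≤ K * orliczM m t := by
  obtain ⟨l, r, -, -, -, -, -, -, hlr⟩ := h.growth
  have hanti : AntitoneOn (fun t => orliczM m t * t ^ (-r)) (Ioi 0) := by
    have hd : ∀ t : ℝ, 0 < t → HasDerivAt (fun t => orliczM m t * t ^ (-r))
        (m t * t * t ^ (-r) + orliczM m t * (-r * t ^ (-r - 1))) t := fun t ht =>
      (h.hasDerivAt ht).mul (Real.hasDerivAt_rpow_const (Or.inl ht.ne'))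
    refine antitoneOn_of_deriv_nonpos (convex_Ioi 0)
      (fun t ht => (hd t ht).continuousAt.continuousWithinAt) ?_ ?_
    · rw [interior_Ioi]
      exact fun t ht => (hd t ht).differentiableAt.differentiableWithinAt
    · rw [interior_Ioi]
      intro t ht
      have ht0 : (0 : ℝ) < t := ht
      rw [(hd t ht).deriv]
      have h1 := (hlr t ht).2
      rw [div_le_iff₀ (h.M_pos ht0.ne')] at h1
      have h2 : t ^ (-r) = t ^ (-r - 1) * t := by
        rw [← Real.rpow_add_one ht0.ne']
        congr 1
        ring
      have h3 : 0 < t ^ (-r - 1) := Real.rpow_pos_of_pos ht0 _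
      rw [h2]
      nlinarith
  set q : ℝ := max |k| 1 with hq
  have hq1 : 1 ≤ q := le_max_right _ _
  have hq0 : 0 < q := by linarith
  have habs : ∀ t, orliczM m |t| = orliczM m t := fun t => by simp [orliczM]
  refine ⟨q ^ r, by positivity, fun t => ?_⟩
  rcases eq_or_ne t 0 with rfl | ht
  · simp [M_zero]
  have ht' : 0 < |t| := abs_pos.2 ht
  have h1 : orliczM m (k * t) ≤ orliczM m (q * |t|) := by
    rw [← habs (k * t)]
    refine h.strictMonoOn_M.monotoneOn (mem_Ici.2 (abs_nonneg _)) (mem_Ici.2 (mul_pos hq0 ht').le) ?_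
    rw [abs_mul]
    exact mul_le_mul_of_nonneg_right (le_max_left _ _) ht'.le
  have h2 := hanti (show |t| ∈ Ioi (0 : ℝ) from ht')
    (show q * |t| ∈ Ioi (0 : ℝ) from mul_pos hq0 ht') (by nlinarith)
  simp only [habs t] at h2
  rw [Real.mul_rpow hq0.le ht'.le] at h2
  have h4 : 0 < |t| ^ (-r) := Real.rpow_pos_of_pos ht' _
  have h5 : orliczM m (q * |t|) * q ^ (-r) ≤ orliczM m t := by
    by_contra hcon
    push Not at hcon
    nlinarith
  rw [Real.rpow_neg hq0.le, ← div_eq_mul_inv, div_le_iff₀ (by positivity)] at h5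
  linarith

theorem nice (h : Admissible N s m V) : Nice (orliczM m) where
  even t := by simp [orliczM]
  zero := M_zero
  pos _ ht := h.M_pos ht
  conv := h.convexOn_M
  scale := h.scale_M

theorem surjOn_M (h : Admissible N s m V) : SurjOn (orliczM m) (Ici 0) (Ici 0) := by
  intro y hy
  have hy0 : (0 : ℝ) ≤ y := hy
  have hM1 : 0 < orliczM m 1 := h.M_pos one_ne_zero
  set T : ℝ := max 1 (y / orliczM m 1) with hT
  have hT1 : 1 ≤ T := le_max_left _ _
  have hT0 : 0 < T := by linarith
  have h1 : y ≤ orliczM m T := by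
    have h2 := h.nice.shrink (a := T⁻¹) (by positivity) (inv_le_one_of_one_le₀ hT1) T
    rw [inv_mul_cancel₀ hT0.ne', le_inv_mul_iff₀ hT0] at h2
    have h3 : y / orliczM m 1 ≤ T := le_max_right _ _
    rw [div_le_iff₀ hM1] at h3
    linarith
  have h2 := intermediate_value_Icc hT0.le (h.continuousOn_M.mono Icc_subset_Ici_self)
  obtain ⟨t, ht, hty⟩ := h2 ⟨by rw [M_zero]; exact hy0, h1⟩
  exact ⟨t, ht.1, hty⟩

/-- `orliczInv m` is indeed the inverse of `M` on `[0,∞)`. -/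
theorem invOn (h : Admissible N s m V) :
    InvOn (orliczInv m) (orliczM m) (Ici 0) (Ici 0) :=
  ⟨h.strictMonoOn_M.injOn.leftInvOn_invFunOn, h.surjOn_M.rightInvOn_invFunOn⟩

theorem monotone_inv (h : Admissible N s m V) :
    Monotone (fun y : ℝ => orliczInv m (max y 0)) := by
  intro a b hab
  have ha : (0 : ℝ) ≤ max a 0 := le_max_right _ _
  have hb : (0 : ℝ) ≤ max b 0 := le_max_right _ _
  have hmem : ∀ y : ℝ, 0 ≤ y → orliczInv m y ∈ Ici (0 : ℝ) := fun y hy =>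
    h.surjOn_M.mapsTo_invFunOn hy
  refine (h.strictMonoOn_M.le_iff_le (hmem _ ha) (hmem _ hb)).1 ?_
  rw [h.invOn.2 ha, h.invOn.2 hb]
  exact max_le_max_right 0 hab

theorem aemeasurable_diffQuot (h : Admissible N s m V) (u : Rn N →ₘ[volume] ℝ) :
    AEMeasurable (diffQuot s m u) ((volume : Measure (Rn N)).prod volume) := by
  have hu : AEMeasurable u (volume : Measure (Rn N)) := u.aemeasurable
  have h1 : AEMeasurable (fun p : Rn N × Rn N => u p.1)
      ((volume : Measure (Rn N)).prod volume) :=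
    hu.comp_quasiMeasurePreserving Measure.quasiMeasurePreserving_fst
  have h2 : AEMeasurable (fun p : Rn N × Rn N => u p.2)
      ((volume : Measure (Rn N)).prod volume) :=
    hu.comp_quasiMeasurePreserving Measure.quasiMeasurePreserving_snd
  have h3 : Measurable (fun p : Rn N × Rn N => ‖p.1 - p.2‖) :=
    (measurable_fst.sub measurable_snd).norm
  have h4 : Measurable (fun p : Rn N × Rn N => orliczInv m (‖p.1 - p.2‖ ^ N)) := by
    have h5 := h.monotone_inv.measurable.comp (h3.pow_const N)
    convert h5 using 1
    funext p
    simp only [Function.comp_apply]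
    rw [max_eq_left (by positivity)]
  exact (h1.sub h2).div ((h3.pow_const s).mul h4).aemeasurable

theorem diffQuot_congr {u v : Rn N → ℝ} (huv : u =ᵐ[volume] v) :
    diffQuot s m u =ᵐ[(volume : Measure (Rn N)).prod volume] diffQuot s m v := by
  filter_upwards [Measure.quasiMeasurePreserving_fst.ae_eq huv,
    Measure.quasiMeasurePreserving_snd.ae_eq huv] with p h1 h2
  simp only [Function.comp_apply] at h1 h2
  simp only [diffQuot, h1, h2]

theorem diffQuot_add (u v : Rn N →ₘ[volume] ℝ) :
    diffQuot s m (u + v : Rn N →ₘ[volume] ℝ)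
      =ᵐ[(volume : Measure (Rn N)).prod volume] fun p => diffQuot s m u p + diffQuot s m v p := by
  refine (diffQuot_congr (AEEqFun.coeFn_add u v)).trans (Eventually.of_forall fun p => ?_)
  simp only [diffQuot, Pi.add_apply]
  ring

theorem diffQuot_smul (k : ℝ) (u : Rn N →ₘ[volume] ℝ) :
    diffQuot s m (k • u : Rn N →ₘ[volume] ℝ)
      =ᵐ[(volume : Measure (Rn N)).prod volume] fun p => k * diffQuot s m u p := by
  refine (diffQuot_congr (AEEqFun.coeFn_smul k u)).trans (Eventually.of_forall fun p => ?_)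
  simp only [diffQuot, Pi.smul_apply, smul_eq_mul]
  ring

theorem weighted_ac : weighted V ≪ (volume : Measure (Rn N)) :=
  withDensity_absolutelyContinuous _ _

theorem aemeasurable_weighted (u : Rn N →ₘ[volume] ℝ) : AEMeasurable u (weighted V) :=
  u.aemeasurable.mono_ac weighted_ac

theorem ac_weighted (h : Admissible N s m V) : (volume : Measure (Rn N)) ≪ weighted V := by
  refine withDensity_absolutelyContinuous' ?_ (Eventually.of_forall fun x => ?_)
  · exact h.V_cont.measurable.ennreal_ofReal.aemeasurable
  · obtain ⟨V₀, h0, hV⟩ := h.V_bound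
    simpa using h0.trans_le (hV x)

theorem mem_carrierE_iff (h : Admissible N s m V) (u : Rn N →ₘ[volume] ℝ) :
    u ∈ carrierE s m V ↔ modular (orliczM m) volume u < ∞ ∧
      modular (orliczM m) ((volume : Measure (Rn N)).prod volume) (diffQuot s m u) < ∞ ∧
      modular (orliczM m) (weighted V) u < ∞ := by
  simp only [carrierE, fracOrliczSobolev, orliczSpace, mem_ofPred_eq, h.nice.exists_iff, and_assoc]

/-- The working space `E`, as a linear subspace of the space of (classes of) measurable
functions on `ℝ^N`. -/
def E (h : Admissible N s m V) : Submodule ℝ (Rn N →ₘ[volume] ℝ) where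
  carrier := carrierE s m V
  zero_mem' := by
    have h0 : ((0 : Rn N →ₘ[volume] ℝ) : Rn N → ℝ) =ᵐ[volume] fun _ => (0 : ℝ) :=
      AEEqFun.coeFn_zero
    rw [h.mem_carrierE_iff, modular_congr h0, modular_congr (diffQuot_congr h0),
      modular_congr (weighted_ac.ae_eq h0)]
    simp [modular, diffQuot, M_zero]
  add_mem' := by
    intro u v hu hv
    rw [h.mem_carrierE_iff] at hu hv ⊢
    have h0 : ((u + v : Rn N →ₘ[volume] ℝ) : Rn N → ℝ) =ᵐ[volume] fun x => u x + v x :=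
      AEEqFun.coeFn_add u v
    rw [modular_congr h0, modular_congr (diffQuot_add u v), modular_congr (weighted_ac.ae_eq h0)]
    exact ⟨h.nice.modular_add_lt u.aemeasurable hu.1 hv.1,
      h.nice.modular_add_lt (h.aemeasurable_diffQuot u) hu.2.1 hv.2.1,
      h.nice.modular_add_lt (aemeasurable_weighted u) hu.2.2 hv.2.2⟩
  smul_mem' := by
    intro k u hu
    rw [h.mem_carrierE_iff] at hu ⊢
    have h0 : ((k • u : Rn N →ₘ[volume] ℝ) : Rn N → ℝ) =ᵐ[volume] fun x => k * u x :=
      AEEqFun.coeFn_smul k u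
    rw [modular_congr h0, modular_congr (diffQuot_smul k u), modular_congr (weighted_ac.ae_eq h0)]
    exact ⟨h.nice.modular_smul_lt k hu.1, h.nice.modular_smul_lt k hu.2.1,
      h.nice.modular_smul_lt k hu.2.2⟩

/-- The Gagliardo seminorm `[u]_{(s,M)}`. -/
def gagliardo (h : Admissible N s m V) (u : h.E) : ℝ :=
  luxemburg (orliczM m) ((volume : Measure (Rn N)).prod volume)
    (diffQuot s m (u : Rn N →ₘ[volume] ℝ))

/-- The norm `‖u‖_{(V,M)}`. -/
def normV (h : Admissible N s m V) (u : h.E) : ℝ :=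
  luxemburg (orliczM m) (weighted V) (u : Rn N →ₘ[volume] ℝ)

/-- The norm of `E`: `‖u‖ = [u]_{(s,M)} + ‖u‖_{(V,M)}`. -/
instance instNorm (h : Admissible N s m V) : Norm h.E := ⟨fun u => h.gagliardo u + h.normV u⟩

theorem normCore (h : Admissible N s m V) : NormedSpace.Core ℝ h.E where
  norm_nonneg u := add_nonneg luxemburg_nonneg luxemburg_nonneg
  norm_smul k u := by
    have hu := (h.mem_carrierE_iff u.1).1 u.2
    have h1 : h.gagliardo (k • u) = |k| * h.gagliardo u := by
      rw [gagliardo, gagliardo, ← h.nice.luxemburg_smul k hu.2.1]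
      exact luxemburg_congr (diffQuot_smul k u.1)
    have h2 : h.normV (k • u) = |k| * h.normV u := by
      rw [normV, normV, ← h.nice.luxemburg_smul k hu.2.2]
      exact luxemburg_congr (weighted_ac.ae_eq (AEEqFun.coeFn_smul k u.1))
    change h.gagliardo (k • u) + h.normV (k • u) = |k| * (h.gagliardo u + h.normV u)
    rw [h1, h2, mul_add]
  norm_triangle u v := by
    have hu := (h.mem_carrierE_iff u.1).1 u.2
    have hv := (h.mem_carrierE_iff v.1).1 v.2
    have h1 : h.gagliardo (u + v) ≤ h.gagliardo u + h.gagliardo v :=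
      (luxemburg_congr (diffQuot_add u.1 v.1)).trans_le
        (h.nice.luxemburg_add_le (h.aemeasurable_diffQuot u.1) hu.2.1 hv.2.1)
    have h2 : h.normV (u + v) ≤ h.normV u + h.normV v :=
      (luxemburg_congr (weighted_ac.ae_eq (AEEqFun.coeFn_add u.1 v.1))).trans_le
        (h.nice.luxemburg_add_le (aemeasurable_weighted u.1) hu.2.2 hv.2.2)
    change h.gagliardo (u + v) + h.normV (u + v) ≤
      h.gagliardo u + h.normV u + (h.gagliardo v + h.normV v)
    linarith
  norm_eq_zero_iff u := by
    have hu := (h.mem_carrierE_iff u.1).1 u.2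
    constructor
    · intro h0
      have h0' : h.gagliardo u + h.normV u = 0 := h0
      have hg : 0 ≤ h.gagliardo u := luxemburg_nonneg
      have hn : 0 ≤ h.normV u := luxemburg_nonneg
      have h1 : h.normV u = 0 := by linarith
      have h2 := h.nice.ae_eq_zero (aemeasurable_weighted u.1) hu.2.2 h1
      have h3 := h.ac_weighted.ae_eq h2
      exact Subtype.ext (AEEqFun.ext (h3.trans AEEqFun.coeFn_zero.symm))
    · rintro rfl
      have h0 : ((0 : Rn N →ₘ[volume] ℝ) : Rn N → ℝ) =ᵐ[volume] fun _ => (0 : ℝ) :=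
        AEEqFun.coeFn_zero
      have h1 : h.gagliardo 0 = 0 := by
        refine (luxemburg_congr (diffQuot_congr h0)).trans ?_
        have : diffQuot s m (fun _ : Rn N => (0 : ℝ)) = fun _ => 0 := by
          funext p
          simp [diffQuot]
        rw [this]
        exact h.nice.luxemburg_zero
      have h2 : h.normV 0 = 0 :=
        (luxemburg_congr (weighted_ac.ae_eq h0)).trans h.nice.luxemburg_zero
      change h.gagliardo 0 + h.normV 0 = 0
      rw [h1, h2, add_zero]

instance instNormedAddCommGroup (h : Admissible N s m V) : NormedAddCommGroup h.E :=
  NormedAddCommGroup.ofCore h.normCore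

instance instNormedSpace (h : Admissible N s m V) : NormedSpace ℝ h.E :=
  NormedSpace.ofCore h.normCore

/-- `G(u) = ∫∫ M(h_u(x,y)) dx dy`. -/
def G (h : Admissible N s m V) (u : h.E) : ℝ :=
  ∫ p, orliczM m (diffQuot s m (u : Rn N →ₘ[volume] ℝ) p) ∂((volume : Measure (Rn N)).prod volume)

/-- `Ψ(u) = ∫ V(x) M(u(x)) dx`. -/
def Psi (h : Admissible N s m V) (u : h.E) : ℝ :=
  ∫ x, V x * orliczM m ((u : Rn N →ₘ[volume] ℝ) x)

/-- `A = G + Ψ`. -/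
def A (h : Admissible N s m V) (u : h.E) : ℝ := h.G u + h.Psi u

end Admissible

end FracOrlicz

end

/-! The argument is uniform convexity at the level of modulars. Put Φ(t) = M(√t). Since Φ is convex
and Φ(0) = 0, it is superadditive. Applied to ((a+b)/2)² + ((a-b)/2)² = (a²+b²)/2, this gives
M((a+b)/2) + M((a-b)/2) ≤ (M(a)+M(b))/2 (`Nice.clarkson`), which integrates to the same inequality
for A (`A_clarkson`).

A is also convex, and A' is a subgradient (`A_differentiableAt`). The subgradient inequality at u_n
gives A(u_n) ≤ A(u) + ⟨A'(u_n), u_n - u⟩; the one at u, tested at the midpoint, gives A((u_n+u)/2) ≥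
A(u) + ½⟨A'(u), u_n - u⟩. Inserted in the Clarkson inequality, they yield A((u_n-u)/2) ≤ ½⟨A'(u_n),
u_n - u⟩ - ½⟨A'(u), u_n - u⟩. The first term tends to 0 by assumption, the second by weak
convergence tested against the single functional A'(u). Under the Δ₂-condition, modular convergence
to 0 is norm convergence (`tendsto_zero_of_A`).

Most of the work is Fréchet differentiability of A: `fderiv` is 0 by default where it fails, so the
subgradient inequality needs it. With g(t) = m(|t|)t, it reduces to a bound on ∫ (g(f+cψ) - g(f))ψ
that is uniform over ψ in the modular unit ball as c → 0 (`exists_increment_le`). -/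

namespace FracOrlicz

/-- A Young function `M` with a density `g` (a subgradient continuous away from the origin)
and at least quadratic growth. -/
structure YoungPair (M g : ℝ → ℝ) : Prop where
  nice : Nice M
  subgrad : ∀ a b, M a + g a * (b - a) ≤ M b
  odd : ∀ t, g (-t) = -g t
  cont : ∀ t, t ≠ 0 → ContinuousAt g t
  quad : ∀ k t : ℝ, 0 ≤ k → k ≤ 1 → M (k * t) ≤ k ^ 2 * M t

/-! ### Pointwise inequalities between a Young function and its density. -/

namespace YoungPair

variable {M g : ℝ → ℝ}

theorem mono (h : YoungPair M g) : Monotone g := by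
  intro a b hab
  rcases hab.eq_or_lt with rfl | hlt
  · exact le_rfl
  · have h1 := h.subgrad a b
    have h2 := h.subgrad b a
    by_contra hcon
    push Not at hcon
    nlinarith

theorem abs_eq (h : YoungPair M g) (t : ℝ) : |g t| = g |t| := by
  have h0 : g 0 = 0 := by
    have := h.odd 0
    rw [neg_zero] at this
    linarith
  rcases le_total 0 t with ht | ht
  · rw [abs_of_nonneg ht, abs_of_nonneg (h0 ▸ h.mono ht)]
  · rw [abs_of_nonpos ht, h.odd, abs_of_nonpos (h0 ▸ h.mono ht)]

theorem abs_le_abs (h : YoungPair M g) {a b : ℝ} (hab : |a| ≤ |b|) : |g a| ≤ |g b| := by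
  rw [h.abs_eq, h.abs_eq]
  exact h.mono hab

/-- The `Δ₂`-condition in terms of the density. -/
theorem exists_growth (h : YoungPair M g) : ∃ C : ℝ, 0 ≤ C ∧ ∀ t, |g t| * |t| ≤ C * M t := by
  obtain ⟨K, hK, hs⟩ := h.nice.scale 2
  refine ⟨K, hK, fun t => ?_⟩
  -- The point 2t bounds g(t)t above by M(2t) - M(t); the point 0 bounds it below by M(t), hence
  -- gives its sign.
  have h1 := h.subgrad t (2 * t)
  have h2 := h.subgrad t 0
  have h3 := hs t
  have h4 := h.nice.nonneg t
  rw [h.nice.zero] at h2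
  rw [← abs_mul, abs_of_nonneg (by nlinarith)]
  nlinarith

/-- A substitute for Young's inequality without the conjugate function: by monotonicity of |g| in
|t|, the larger of |a|, |b| may replace the other. -/
theorem abs_mul_le (h : YoungPair M g) {C : ℝ} (hC : 0 ≤ C) (hg : ∀ t, |g t| * |t| ≤ C * M t)
    (a b : ℝ) : |g a * b| ≤ C * (M a + M b) := by
  rw [abs_mul]
  have ha := h.nice.nonneg a
  have hb := h.nice.nonneg b
  rcases le_total |b| |a| with hab | hab
  · calc |g a| * |b| ≤ |g a| * |a| := by gcongr
      _ ≤ C * M a := hg a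
      _ ≤ _ := by nlinarith
  · calc |g a| * |b| ≤ |g b| * |b| := mul_le_mul_of_nonneg_right (h.abs_le_abs hab) (abs_nonneg _)
      _ ≤ C * M b := hg b
      _ ≤ _ := by nlinarith

theorem abs_sub_le_two_mul (h : YoungPair M g) {a b c : ℝ} (ha : |a| ≤ |c|) (hb : |b| ≤ |c|) :
    |g a - g b| ≤ 2 * |g c| := by
  have := abs_sub (g a) (g b)
  linarith [h.abs_le_abs ha, h.abs_le_abs hb]

/-- Quadratic growth contributes k², and one factor k is cancelled against |kt|. The surviving k
supplies the smallness in `increment_mul_le`. -/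
theorem abs_scaled_mul_le (h : YoungPair M g) {C : ℝ} (hg : ∀ t, |g t| * |t| ≤ C * M t)
    (hC : 0 ≤ C) {k : ℝ} (hk : 0 < k) (hk1 : k ≤ 1) (t : ℝ) : |g (k * t)| * |t| ≤ C * k * M t := by
  have h1 := hg (k * t)
  have h2 := h.quad k t hk.le hk1
  rw [abs_mul, abs_of_pos hk] at h1
  have h3 : k * (|g (k * t)| * |t|) ≤ k * (C * k * M t) := by nlinarith
  exact le_of_mul_le_mul_left h3 hk

/-- The oscillation `|g ((1 + δ) a) - g ((1 - δ) a)| |a|`. -/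
theorem osc_mul_le (h : YoungPair M g) {C : ℝ} (hg : ∀ t, |g t| * |t| ≤ C * M t) {δ : ℝ}
    (hδ : 0 < δ) (hδ1 : δ ≤ 1) (a : ℝ) :
    |g ((1 + δ) * a) - g ((1 - δ) * a)| * |a| ≤ C * M (2 * a) := by
  have h1 : |g ((1 + δ) * a) - g ((1 - δ) * a)| ≤ 2 * |g (2 * a)| := by
    refine h.abs_sub_le_two_mul ?_ ?_ <;> rw [abs_mul, abs_mul, abs_two] <;>
      refine mul_le_mul_of_nonneg_right (abs_le.2 ⟨?_, ?_⟩) (abs_nonneg a) <;> linarith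
  have h2 := hg (2 * a)
  rw [abs_mul, abs_two] at h2
  nlinarith [abs_nonneg a]

/-- Three regimes. If cb is not small relative to a, both arguments of g are at most c(1 + 1/δ)|b|
in modulus. If |cb| ≤ δ|a|, the increment is at most the oscillation of g between (1 ± δ)a: for |b|
≤ K|a| this is the first term on the right, and for |b| ≥ K|a| both endpoints are at most (2/K)|b|.
In the first and last regimes `abs_scaled_mul_le` gives a small multiple of M(b). -/
theorem increment_mul_le (h : YoungPair M g) {C : ℝ} (hC : 0 ≤ C)
    (hg : ∀ t, |g t| * |t| ≤ C * M t) {δ K c : ℝ} (hδ : 0 < δ) (hδ1 : δ ≤ 1) (hK : 2 ≤ K)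
    (hc : 0 < c) (hcδ : c * (1 + 1 / δ) ≤ 1) (a b : ℝ) :
    (g (a + c * b) - g a) * b ≤ K * (|g ((1 + δ) * a) - g ((1 - δ) * a)| * |a|) +
      (4 * C / K + 2 * C * (c * (1 + 1 / δ))) * M b := by
  have hMb := h.nice.nonneg b
  have hK0 : 0 < K := by linarith
  have hδc : 0 < c * (1 + 1 / δ) := by positivity
  have hw : 0 ≤ K * (|g ((1 + δ) * a) - g ((1 - δ) * a)| * |a|) := by positivity
  have hx : 0 ≤ 4 * C / K * M b := by positivity
  have hy : 0 ≤ 2 * C * (c * (1 + 1 / δ)) * M b := by positivity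
  refine (le_abs_self _).trans ?_
  rw [abs_mul, add_mul (4 * C / K)]
  rcases le_total (δ * |a|) (c * |b|) with hab | hab
  · have ha : |a| ≤ c * |b| * (1 / δ) := by
      rw [mul_one_div, le_div_iff₀ hδ]
      linarith
    have hcb : 0 ≤ c * |b| := by positivity
    have habs : |c * (1 + 1 / δ) * b| = c * |b| + c * |b| * (1 / δ) := by
      rw [abs_mul, abs_of_pos hδc]; ring
    have h1 : |g (a + c * b) - g a| ≤ 2 * |g (c * (1 + 1 / δ) * b)| := by
      refine h.abs_sub_le_two_mul ?_ ?_
      · refine (abs_add_le _ _).trans ?_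
        rw [habs, abs_mul, abs_of_pos hc]
        linarith
      · rw [habs]; linarith
    have h2 := h.abs_scaled_mul_le hg hC hδc hcδ b
    nlinarith [abs_nonneg b]
  · have h1 : |g (a + c * b) - g a| ≤ |g ((1 + δ) * a) - g ((1 - δ) * a)| := by
      have hcb : |c * b| ≤ δ * |a| := by rwa [abs_mul, abs_of_pos hc]
      have hcb' := abs_le.1 hcb
      rcases le_total 0 a with ha | ha
      · rw [abs_of_nonneg ha] at hcb'
        have e1 : g (a + c * b) ≤ g ((1 + δ) * a) := h.mono (by linarith)
        have e2 : g ((1 - δ) * a) ≤ g (a + c * b) := h.mono (by linarith)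
        have e3 : g a ≤ g ((1 + δ) * a) := h.mono (by nlinarith)
        have e4 : g ((1 - δ) * a) ≤ g a := h.mono (by nlinarith)
        exact le_trans (abs_le.2 ⟨by linarith, by linarith⟩) (le_abs_self _)
      · rw [abs_of_nonpos ha] at hcb'
        have e1 : g (a + c * b) ≤ g ((1 - δ) * a) := h.mono (by linarith)
        have e2 : g ((1 + δ) * a) ≤ g (a + c * b) := h.mono (by linarith)
        have e3 : g a ≤ g ((1 - δ) * a) := h.mono (by nlinarith)
        have e4 : g ((1 + δ) * a) ≤ g a := h.mono (by nlinarith)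
        exact le_trans (abs_le.2 ⟨by linarith, by linarith⟩) (neg_le_abs _)
    rcases le_total |b| (K * |a|) with hba | hba
    · have : |g (a + c * b) - g a| * |b| ≤
          |g ((1 + δ) * a) - g ((1 - δ) * a)| * (K * |a|) := by gcongr
      linarith
    · have hk : |a| ≤ 1 / K * |b| := by
        rw [one_div, le_inv_mul_iff₀ hK0]; exact hba
      have habs : |2 / K * b| = 2 * (1 / K * |b|) := by
        rw [abs_mul, abs_of_pos (by positivity)]; ring
      have h2 : |g ((1 + δ) * a) - g ((1 - δ) * a)| ≤ 2 * |g (2 / K * b)| := by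
        refine h.abs_sub_le_two_mul ?_ ?_ <;> rw [habs, abs_mul]
        · refine mul_le_mul ?_ hk (abs_nonneg _) (by norm_num)
          exact abs_le.2 ⟨by linarith, by linarith⟩
        · refine mul_le_mul ?_ hk (abs_nonneg _) (by norm_num)
          exact abs_le.2 ⟨by linarith, by linarith⟩
      have h3 := h.abs_scaled_mul_le hg hC (k := 2 / K) (by positivity)
        ((div_le_one hK0).2 hK) b
      have h4 : |g (a + c * b) - g a| * |b| ≤ 2 * |g (2 / K * b)| * |b| := by
        gcongr; exact h1.trans h2
      have h5 : 4 * C / K * M b = 2 * (C * (2 / K) * M b) := by ring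
      nlinarith

end YoungPair

/-! ### Consequences of the convexity of M(√t). -/

theorem Nice.eq_sqrt_sq {M : ℝ → ℝ} (h : Nice M) (t : ℝ) : M t = M (Real.sqrt (t ^ 2)) := by
  rw [Real.sqrt_sq_eq_abs]
  rcases abs_cases t with ⟨e, _⟩ | ⟨e, _⟩ <;> rw [e]
  rw [h.even]

/-- If `t ↦ M (√t)` is convex, then `M` satisfies a Clarkson-type inequality. -/
theorem Nice.clarkson {M : ℝ → ℝ} (h : Nice M)
    (hc : ConvexOn ℝ (Ici 0) (fun t : ℝ => M (Real.sqrt t))) (a b : ℝ) :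
    M (1 / 2 * (a + b)) + M (1 / 2 * (a - b)) ≤ 1 / 2 * M a + 1 / 2 * M b := by
  have hshrink : ∀ x y : ℝ, 0 ≤ x → 0 ≤ y → 0 < x + y →
      -- Convexity between 0 and x + y; adding this to its mirror image in x and y gives
      -- superadditivity.
      M (Real.sqrt x) ≤ x / (x + y) * M (Real.sqrt (x + y)) := fun x y hx hy hxy => by
    have := hc.2 (show x + y ∈ Ici (0 : ℝ) from hxy.le) (mem_Ici.2 (le_refl (0 : ℝ)))
      (show 0 ≤ x / (x + y) by positivity) (show 0 ≤ y / (x + y) by positivity) (by field_simp)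
    simp only [smul_eq_mul, mul_zero, add_zero, Real.sqrt_zero, h.zero] at this
    rwa [div_mul_cancel₀ _ hxy.ne'] at this
  have hsuper : ∀ x y : ℝ, 0 ≤ x → 0 ≤ y →
      M (Real.sqrt x) + M (Real.sqrt y) ≤ M (Real.sqrt (x + y)) := fun x y hx hy => by
    rcases (add_nonneg hx hy).eq_or_lt with h0 | hxy
    · have hx0 : x = 0 := by linarith
      have hy0 : y = 0 := by linarith
      simp [hx0, hy0, h.zero]
    · have h1 := hshrink x y hx hy hxy
      have h2 := hshrink y x hy hx (by linarith)
      rw [add_comm y x] at h2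
      have h3 : x / (x + y) * M (Real.sqrt (x + y)) + y / (x + y) * M (Real.sqrt (x + y)) =
          M (Real.sqrt (x + y)) := by field_simp
      linarith
  rw [h.eq_sqrt_sq (1 / 2 * (a + b)), h.eq_sqrt_sq (1 / 2 * (a - b)), h.eq_sqrt_sq a, h.eq_sqrt_sq b]
  refine (hsuper _ _ (sq_nonneg _) (sq_nonneg _)).trans ?_
  have := hc.2 (show a ^ 2 ∈ Ici (0 : ℝ) from sq_nonneg a) (show b ^ 2 ∈ Ici (0 : ℝ) from sq_nonneg b)
    (show (0 : ℝ) ≤ 1 / 2 by norm_num) (show (0 : ℝ) ≤ 1 / 2 by norm_num) (by norm_num)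
  simp only [smul_eq_mul] at this
  convert this using 3
  ring

/-- If `t ↦ M (√t)` is convex, then `M` grows at least quadratically. -/
theorem Nice.quadratic {M : ℝ → ℝ} (h : Nice M)
    (hc : ConvexOn ℝ (Ici 0) (fun t : ℝ => M (Real.sqrt t))) (k t : ℝ) (hk : 0 ≤ k) (hk1 : k ≤ 1) :
    M (k * t) ≤ k ^ 2 * M t := by
  have := hc.2 (show t ^ 2 ∈ Ici (0 : ℝ) from sq_nonneg t) (mem_Ici.2 (le_refl (0 : ℝ)))
    (show 0 ≤ k ^ 2 by positivity) (show 0 ≤ 1 - k ^ 2 by nlinarith) (by ring)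
  simp only [smul_eq_mul, mul_zero, add_zero, Real.sqrt_zero, h.zero] at this
  rw [h.eq_sqrt_sq (k * t), h.eq_sqrt_sq t, mul_pow]
  exact this

theorem Admissible.youngPair {N : ℕ} {s : ℝ} {m : ℝ → ℝ} {V : Rn N → ℝ} (h : Admissible N s m V)
    (hc : ConvexOn ℝ (Ici 0) (fun t : ℝ => orliczM m (Real.sqrt t))) :
    YoungPair (orliczM m) (fun t => m |t| * t) where
  nice := h.nice
  subgrad := by
    have hpos : ∀ a b, 0 < a → orliczM m a + m |a| * a * (b - a) ≤ orliczM m b := by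
      intro a b ha
      rw [abs_of_pos ha]
      rcases lt_trichotomy a b with hab | rfl | hab
      · have h1 := h.convexOn_M.le_slope_of_hasDerivAt (mem_univ a) (mem_univ b) hab (h.hasDerivAt ha)
        rw [slope_def_field, le_div_iff₀ (by linarith)] at h1
        linarith
      · simp
      · have h1 := h.convexOn_M.slope_le_of_hasDerivAt (mem_univ b) (mem_univ a) hab (h.hasDerivAt ha)
        rw [slope_def_field, div_le_iff₀ (by linarith)] at h1
        linarith
    intro a b
    rcases lt_trichotomy a 0 with ha | rfl | ha
    · have h1 := hpos (-a) (-b) (by linarith)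
      rw [h.nice.even, h.nice.even, abs_neg] at h1
      calc _ = orliczM m a + m |a| * -a * (-b - -a) := by ring
        _ ≤ _ := h1
    -- At the origin the density is 0 whatever the value `m 0`, and 0 is a subgradient there because
    -- M ≥ 0 = M(0).
    · simpa [h.nice.zero] using h.nice.nonneg b
    · exact hpos a b ha
  odd t := by rw [abs_neg]; ring
  cont t ht := by
    have ht' : 0 < |t| := abs_pos.2 ht
    have h1 : ContinuousAt m |t| := h.contDiff.continuousOn.continuousAt (Ioi_mem_nhds ht')
    exact (ContinuousAt.comp (f := fun t : ℝ => |t|) h1 continuous_abs.continuousAt).mul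
      continuousAt_id
  quad := h.nice.quadratic hc

end FracOrlicz

namespace FracOrlicz

/-! ### Modulars, Luxemburg norms and the superposition operator of g. -/

section Modular

variable {Y : Type*} [MeasurableSpace Y] {M g : ℝ → ℝ} {μ : Measure Y} {f φ : Y → ℝ}

theorem Nice.integrable (h : Nice M) (hm : AEMeasurable f μ) (hf : modular M μ f < ∞) :
    Integrable (fun y => M (f y)) μ := by
  refine ⟨(h.continuous.measurable.comp_aemeasurable hm).aestronglyMeasurable, ?_⟩
  rw [hasFiniteIntegral_iff_ofReal (Eventually.of_forall fun y => h.nonneg _)]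
  exact hf

theorem Nice.ofReal_integral (h : Nice M) (hm : AEMeasurable f μ) (hf : modular M μ f < ∞) :
    ENNReal.ofReal (∫ y, M (f y) ∂μ) = modular M μ f :=
  ofReal_integral_eq_lintegral_ofReal (h.integrable hm hf)
    (Eventually.of_forall fun _ => h.nonneg _)

theorem Nice.integral_le_one (h : Nice M) (hm : AEMeasurable f μ) (hf : modular M μ f ≤ 1) :
    ∫ y, M (f y) ∂μ ≤ 1 := by
  rw [← ENNReal.ofReal_le_one, h.ofReal_integral hm (hf.trans_lt ENNReal.one_lt_top)]
  exact hf

/-- Strict inequality provides an admissible constant below c, so attainment of the infimum need not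
be discussed. -/
theorem Nice.modular_div_le_one (h : Nice M) (hf : modular M μ f < ∞) {c : ℝ}
    (hc : luxemburg M μ f < c) : modular M μ (fun y => f y / c) ≤ 1 := by
  obtain ⟨a, ⟨ha, hfa⟩, hac⟩ := exists_lt_of_csInf_lt (h.luxSet_nonempty hf) hc
  have hc0 : 0 < c := ha.trans hac
  refine le_trans (lintegral_mono fun y => ENNReal.ofReal_le_ofReal ?_) hfa
  have h1 := h.shrink (a := a / c) (by positivity) ((div_le_one hc0).2 hac.le) (f y / a)
  have h2 : a / c * (f y / a) = f y / c := by field_simp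
  rw [h2] at h1
  refine h1.trans (mul_le_of_le_one_left (h.nonneg _) ((div_le_one hc0).2 hac.le))

/-- Modular convergence to `0` implies norm convergence to `0`. -/
theorem Nice.tendsto_luxemburg (h : Nice M) {F : ℕ → Y → ℝ} (hm : ∀ n, AEMeasurable (F n) μ)
    (hF : ∀ n, modular M μ (F n) < ∞)
    (hlim : Tendsto (fun n => ∫ y, M (F n y) ∂μ) atTop (𝓝 0)) :
    Tendsto (fun n => luxemburg M μ (F n)) atTop (𝓝 0) := by
  rw [Metric.tendsto_atTop]
  intro ε hε
  obtain ⟨K, hK, hs⟩ := h.scale (ε / 2)⁻¹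
  -- Below this threshold the modular of F_n/(ε/2) is at most K/(K+1) ≤ 1; the added 1 covers K = 0.
  obtain ⟨n₀, hn₀⟩ := Metric.tendsto_atTop.1 hlim (K + 1)⁻¹ (by positivity)
  refine ⟨n₀, fun n hn => ?_⟩
  have h1 := lt_of_abs_lt (by simpa using hn₀ n hn : |∫ y, M (F n y) ∂μ| < (K + 1)⁻¹)
  rw [Real.dist_eq, sub_zero, abs_of_nonneg luxemburg_nonneg]
  refine (csInf_le luxSet_bddBelow ⟨half_pos hε, ?_⟩).trans_lt (half_lt_self hε)
  refine (modular_le_mul hK fun y => (by rw [div_eq_inv_mul]; exact hs (F n y))).trans ?_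
  rw [← h.ofReal_integral (hm n) (hF n), ← ENNReal.ofReal_mul hK, ENNReal.ofReal_le_one]
  calc K * ∫ y, M (F n y) ∂μ ≤ K * (K + 1)⁻¹ := by gcongr
    _ ≤ 1 := by
      rw [← div_eq_mul_inv, div_le_one (by positivity)]
      linarith

namespace YoungPair

theorem integrable_mul (h : YoungPair M g) (hf : AEMeasurable f μ) (hφ : AEMeasurable φ μ)
    (hf' : modular M μ f < ∞) (hφ' : modular M μ φ < ∞) :
    Integrable (fun y => g (f y) * φ y) μ := by
  obtain ⟨C, hC, hg⟩ := h.exists_growth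
  refine (((h.nice.integrable hf hf').add (h.nice.integrable hφ hφ')).const_mul C).mono'
    ((h.mono.measurable.comp_aemeasurable hf).mul hφ).aestronglyMeasurable
    (Eventually.of_forall fun y => ?_)
  exact h.abs_mul_le hC hg _ _

/-- Dominated convergence with majorant C M(2f). The factor |f| vanishes where f = 0, so continuity
of g away from the origin suffices. -/
theorem tendsto_integral_osc (h : YoungPair M g) (hf : AEMeasurable f μ)
    (hf' : modular M μ f < ∞) :
    Tendsto (fun δ : ℝ => ∫ y, |g ((1 + δ) * f y) - g ((1 - δ) * f y)| * |f y| ∂μ)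
      (𝓝[>] 0) (𝓝 0) := by
  obtain ⟨C, hC, hg⟩ := h.exists_growth
  have hmeas : ∀ k : ℝ, AEMeasurable (fun y => g (k * f y)) μ := fun k =>
    h.mono.measurable.comp_aemeasurable (hf.const_mul k)
  suffices Tendsto (fun δ : ℝ => ∫ y, |g ((1 + δ) * f y) - g ((1 - δ) * f y)| * |f y| ∂μ)
      (𝓝[>] 0) (𝓝 (∫ _ : Y, (0 : ℝ) ∂μ)) by rwa [integral_zero] at this
  refine tendsto_integral_filter_of_dominated_convergence (fun y => C * M (2 * f y))
    (Eventually.of_forall fun δ => ?_) ?_ ?_ (Eventually.of_forall fun y => ?_)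
  · have h1 : AEMeasurable (fun y => |g ((1 + δ) * f y) - g ((1 - δ) * f y)|) μ :=
      ((hmeas _).sub (hmeas _)).norm
    exact (h1.mul hf.norm).aestronglyMeasurable
  · filter_upwards [Ioo_mem_nhdsGT (zero_lt_one' ℝ)] with δ hδ
    refine Eventually.of_forall fun y => ?_
    rw [Real.norm_of_nonneg (by positivity)]
    exact h.osc_mul_le hg hδ.1 hδ.2.le _
  · exact (h.nice.integrable (hf.const_mul 2) (h.nice.modular_smul_lt 2 hf')).const_mul C
  · rcases eq_or_ne (f y) 0 with hy | hy
    · simp [hy]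
    refine Tendsto.mono_left ?_ nhdsWithin_le_nhds
    have e1 : Tendsto (fun δ : ℝ => g ((1 + δ) * f y)) (𝓝 0) (𝓝 (g (f y))) := by
      refine (h.cont _ hy).tendsto.comp ?_
      have : Continuous fun δ : ℝ => (1 + δ) * f y := by fun_prop
      simpa using this.tendsto 0
    have e2 : Tendsto (fun δ : ℝ => g ((1 - δ) * f y)) (𝓝 0) (𝓝 (g (f y))) := by
      refine (h.cont _ hy).tendsto.comp ?_
      have : Continuous fun δ : ℝ => (1 - δ) * f y := by fun_prop
      simpa using this.tendsto 0
    simpa using ((e1.sub e2).abs).mul_const |f y|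

/-- Continuity of the superposition operator `f ↦ g ∘ f`, tested against the unit ball. -/
theorem exists_increment_le (h : YoungPair M g) (hf : AEMeasurable f μ)
    (hf' : modular M μ f < ∞) {ε : ℝ} (hε : 0 < ε) :
    ∃ c₀ : ℝ, 0 < c₀ ∧ ∀ c : ℝ, 0 < c → c < c₀ → ∀ ψ : Y → ℝ, AEMeasurable ψ μ →
      modular M μ ψ ≤ 1 → ∫ y, (g (f y + c * ψ y) - g (f y)) * ψ y ∂μ ≤ ε := by
  obtain ⟨C, hC, hg⟩ := h.exists_growth
  -- The three terms of `increment_mul_le` each receive ε/3. K depends on ε alone, then δ makes the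
  -- oscillation integral less than ε/(3K), and only then is c bounded in terms of δ.
  set K : ℝ := 2 + 12 * C / ε with hK
  have hK2 : 2 ≤ K := by rw [hK]; linarith [show 0 ≤ 12 * C / ε by positivity]
  have hK0 : 0 < K := by linarith
  have hKC : 4 * C / K ≤ ε / 3 := by
    rw [div_le_iff₀ hK0, hK]
    have : ε / 3 * (2 + 12 * C / ε) = ε / 3 * 2 + 4 * C := by field_simp; ring
    linarith
  obtain ⟨δ, hδε, hδ⟩ := (((h.tendsto_integral_osc hf hf').eventually
    (gt_mem_nhds (show 0 < ε / 3 / K by positivity))).and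
      (Ioo_mem_nhdsGT (zero_lt_one' ℝ))).exists
  have hD : 0 < 1 + 1 / δ := by have := hδ.1; positivity
  refine ⟨min (1 / (1 + 1 / δ)) (ε / 3 / ((2 * C + 1) * (1 + 1 / δ))), by positivity, ?_⟩
  intro c hc hcc ψ hψ hψ1
  have hc1 : c * (1 + 1 / δ) ≤ 1 := by
    rw [← le_div_iff₀ hD]
    exact hcc.le.trans (min_le_left _ _)
  have hc2 : 2 * C * (c * (1 + 1 / δ)) ≤ ε / 3 := by
    have h1 := hcc.le.trans (min_le_right _ _)
    rw [le_div_iff₀ (by positivity)] at h1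
    have h2 : 0 ≤ c * (1 + 1 / δ) := by positivity
    linarith
  have hψ' : modular M μ ψ < ∞ := hψ1.trans_lt ENNReal.one_lt_top
  have hosc : Integrable (fun y => |g ((1 + δ) * f y) - g ((1 - δ) * f y)| * |f y|) μ := by
    have e1 := h.integrable_mul (hf.const_mul (1 + δ)) hf (h.nice.modular_smul_lt _ hf') hf'
    have e2 := h.integrable_mul (hf.const_mul (1 - δ)) hf (h.nice.modular_smul_lt _ hf') hf'
    refine (e1.sub e2).abs.congr (Eventually.of_forall fun y => ?_)
    simp only [Pi.sub_apply]
    rw [← abs_mul, sub_mul (g _)]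
  calc ∫ y, (g (f y + c * ψ y) - g (f y)) * ψ y ∂μ
      ≤ ∫ y, (K * (|g ((1 + δ) * f y) - g ((1 - δ) * f y)| * |f y|) +
          (4 * C / K + 2 * C * (c * (1 + 1 / δ))) * M (ψ y)) ∂μ := by
        refine integral_mono_of_nonneg (Eventually.of_forall fun y => ?_)
          ((hosc.const_mul _).add ((h.nice.integrable hψ hψ').const_mul _))
          (Eventually.of_forall fun y => h.increment_mul_le hC hg hδ.1 hδ.2.le hK2 hc hc1 _ _)
        -- The integrand is nonnegative by monotonicity of g, so only the majorant has to be
        -- integrable.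
        rcases le_total 0 (ψ y) with hy | hy
        · exact mul_nonneg (sub_nonneg.2 (h.mono (by nlinarith))) hy
        · exact mul_nonneg_of_nonpos_of_nonpos (sub_nonpos.2 (h.mono (by nlinarith))) hy
    _ = K * ∫ y, |g ((1 + δ) * f y) - g ((1 - δ) * f y)| * |f y| ∂μ +
          (4 * C / K + 2 * C * (c * (1 + 1 / δ))) * ∫ y, M (ψ y) ∂μ := by
        rw [integral_add (hosc.const_mul _) ((h.nice.integrable hψ hψ').const_mul _),
          integral_const_mul, integral_const_mul]
    _ ≤ K * (ε / 3 / K) + (ε / 3 + ε / 3) * 1 := by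
        have h1 := h.nice.integral_le_one hψ hψ1
        have h2 : 0 ≤ ∫ y, M (ψ y) ∂μ := integral_nonneg fun y => h.nice.nonneg _
        gcongr
    _ = ε := by field_simp; ring

end YoungPair

end Modular

/-! ### Differentiability and convexity of modulars along bounded linear maps. -/

/-- A bounded linear map from a normed space into the Orlicz space of `M` over `μ`. -/
structure IsOrliczMap {F Y : Type*} [NormedAddCommGroup F] [NormedSpace ℝ F] [MeasurableSpace Y]
    (M : ℝ → ℝ) (μ : Measure Y) (T : F → Y → ℝ) : Prop where
  aemeas : ∀ u, AEMeasurable (T u) μ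
  add : ∀ u v, T (u + v) =ᵐ[μ] fun y => T u y + T v y
  smul : ∀ (k : ℝ) u, T (k • u) =ᵐ[μ] fun y => k * T u y
  finite : ∀ u, modular M μ (T u) < ∞
  lux_le : ∀ u, luxemburg M μ (T u) ≤ ‖u‖

namespace IsOrliczMap

variable {F Y : Type*} [NormedAddCommGroup F] [NormedSpace ℝ F] [MeasurableSpace Y]
  {M g : ℝ → ℝ} {μ : Measure Y} {T : F → Y → ℝ}

theorem sub (hT : IsOrliczMap M μ T) (u v : F) : T (u - v) =ᵐ[μ] fun y => T u y - T v y := by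
  have h1 := hT.add u ((-1 : ℝ) • v)
  have h2 := hT.smul (-1) v
  rw [neg_one_smul, ← sub_eq_add_neg] at h1
  rw [neg_one_smul] at h2
  filter_upwards [h1, h2] with y e1 e2
  rw [e1, e2]
  ring

/-- The modular is Fréchet differentiable along a bounded linear map, and its derivative is a
subgradient. -/
theorem exists_hasFDerivAt (hT : IsOrliczMap M μ T) (h : YoungPair M g) (u : F) :
    ∃ L : F →L[ℝ] ℝ, HasFDerivAt (fun w => ∫ y, M (T w y) ∂μ) L u ∧
      ∀ v, ∫ y, M (T u y) ∂μ + L (v - u) ≤ ∫ y, M (T v y) ∂μ := by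
  obtain ⟨C, hC, hg⟩ := h.exists_growth
  have hM : ∀ w, Integrable (fun y => M (T w y)) μ := fun w =>
    h.nice.integrable (hT.aemeas w) (hT.finite w)
  have hgi : ∀ w v, Integrable (fun y => g (T w y) * T v y) μ := fun w v =>
    h.integrable_mul (hT.aemeas w) (hT.aemeas v) (hT.finite w) (hT.finite v)
  have hone : ∀ w : F, ∀ c : ℝ, ‖w‖ < c → modular M μ (fun y => T w y / c) ≤ 1 := fun w c hc =>
    h.nice.modular_div_le_one (hT.finite w) ((hT.lux_le w).trans_lt hc)
  let L₀ : F →ₗ[ℝ] ℝ :=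
    { toFun := fun v => ∫ y, g (T u y) * T v y ∂μ
      map_add' := fun v w => by
        rw [← integral_add (hgi u v) (hgi u w)]
        refine integral_congr_ae ?_
        filter_upwards [hT.add v w] with y hy
        rw [hy]; ring
      map_smul' := fun k v => by
        rw [RingHom.id_apply, smul_eq_mul, ← integral_const_mul]
        refine integral_congr_ae ?_
        filter_upwards [hT.smul k v] with y hy
        rw [hy]; ring }
  have hL₀ : ∀ v, L₀ v = ∫ y, g (T u y) * T v y ∂μ := fun _ => rfl
  set B : ℝ := C * (∫ y, M (T u y) ∂μ + 1) with hB
  have hu0 : 0 ≤ ∫ y, M (T u y) ∂μ := integral_nonneg fun y => h.nice.nonneg _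
  have hbound : ∀ v, ‖L₀ v‖ ≤ 2 * B * ‖v‖ := by
    intro v
    rcases eq_or_ne v 0 with rfl | hv
    · simp
    have hv0 : 0 < ‖v‖ := norm_pos_iff.2 hv
    -- Dividing by 2‖v‖ instead of ‖v‖ makes the Luxemburg norm strictly less than 1, as
    -- `modular_div_le_one` requires.
    have hc : 0 < 2 * ‖v‖ := by positivity
    have h1 := hone v (2 * ‖v‖) (by linarith)
    have hdiv : AEMeasurable (fun y => T v y / (2 * ‖v‖)) μ := (hT.aemeas v).div_const _
    have hMdiv := h.nice.integrable hdiv (h1.trans_lt ENNReal.one_lt_top)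
    have h2 : L₀ v = 2 * ‖v‖ * ∫ y, g (T u y) * (T v y / (2 * ‖v‖)) ∂μ := by
      rw [hL₀, ← integral_const_mul]
      refine integral_congr_ae (Eventually.of_forall fun y => ?_)
      simp only
      field_simp
    have h3 : ‖∫ y, g (T u y) * (T v y / (2 * ‖v‖)) ∂μ‖ ≤ B := by
      calc _ ≤ ∫ y, C * (M (T u y) + M (T v y / (2 * ‖v‖))) ∂μ :=
            norm_integral_le_of_norm_le (((hM u).add hMdiv).const_mul C)
              (Eventually.of_forall fun y => h.abs_mul_le hC hg _ _)
        _ = C * (∫ y, M (T u y) ∂μ + ∫ y, M (T v y / (2 * ‖v‖)) ∂μ) := by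
            rw [integral_const_mul, integral_add (hM u) hMdiv]
        _ ≤ B := by
            rw [hB]
            gcongr
            exact h.nice.integral_le_one hdiv h1
    rw [h2, norm_mul, Real.norm_of_nonneg hc.le]
    nlinarith
  have hrem : ∀ w, ∫ y, M (T (u + w) y) ∂μ - ∫ y, M (T u y) ∂μ - L₀ w =
      ∫ y, (M (T u y + T w y) - M (T u y) - g (T u y) * T w y) ∂μ := by
    intro w
    rw [hL₀, ← integral_sub (hM _) (hM _), ← integral_sub (by exact (hM _).sub (hM _)) (hgi _ _)]
    refine integral_congr_ae ?_
    filter_upwards [hT.add u w] with y hy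
    simp only [hy]
  have hnonneg : ∀ a b : ℝ, 0 ≤ M (a + b) - M a - g a * b := fun a b => by
    have := h.subgrad a (a + b)
    rw [add_sub_cancel_left] at this
    linarith
  refine ⟨L₀.mkContinuous (2 * B) hbound, ?_, fun v => ?_⟩
  · rw [hasFDerivAt_iff_isLittleO_nhds_zero, Asymptotics.isLittleO_iff]
    intro ε hε
    obtain ⟨c₀, hc₀, hsmall⟩ := h.exists_increment_le (hT.aemeas u) (hT.finite u) (half_pos hε)
    filter_upwards [Metric.ball_mem_nhds (0 : F) (half_pos hc₀)] with w hw
    rw [mem_ball_zero_iff] at hw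
    rw [LinearMap.mkContinuous_apply, hrem]
    rw [Real.norm_of_nonneg (integral_nonneg fun y => hnonneg _ _)]
    rcases eq_or_ne w 0 with rfl | hw0
    · have h0 := hrem 0
      simp only [add_zero, map_zero, sub_self] at h0
      rw [← h0]
      simp
    have hw0' : 0 < ‖w‖ := norm_pos_iff.2 hw0
    have hc : 0 < 2 * ‖w‖ := by positivity
    have h1 := hsmall (2 * ‖w‖) hc (by linarith) (fun y => T w y / (2 * ‖w‖))
      ((hT.aemeas w).div_const _) (hone w _ (by linarith))
    calc ∫ y, (M (T u y + T w y) - M (T u y) - g (T u y) * T w y) ∂μ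
        ≤ ∫ y, (g (T u y + T w y) - g (T u y)) * T w y ∂μ := by
          refine integral_mono_of_nonneg (Eventually.of_forall fun y => hnonneg _ _) ?_
            (Eventually.of_forall fun y => ?_)
          · refine ((hgi (u + w) w).sub (hgi u w)).congr ?_
            filter_upwards [hT.add u w] with y hy
            simp only [Pi.sub_apply, hy]
            ring
          -- The subgradient at the displaced point bounds the Taylor remainder by the increment of
          -- g times the displacement.
          · have := h.subgrad (T u y + T w y) (T u y)
            simp only
            nlinarith
      -- Normalising w to the modular unit ball extracts a factor 2‖w‖; the uniform bound ε/2 on the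
      -- integral then gives ε‖w‖.
      _ = 2 * ‖w‖ * ∫ y, (g (T u y + 2 * ‖w‖ * (T w y / (2 * ‖w‖))) - g (T u y)) *
            (T w y / (2 * ‖w‖)) ∂μ := by
          rw [← integral_const_mul]
          refine integral_congr_ae (Eventually.of_forall fun y => ?_)
          simp only
          rw [mul_div_cancel₀ _ hc.ne']
          field_simp
      _ ≤ 2 * ‖w‖ * (ε / 2) := by gcongr
      _ = ε * ‖w‖ := by ring
  · have h1 := hrem (v - u)
    rw [add_sub_cancel] at h1
    have h2 : 0 ≤ ∫ y, (M (T u y + T (v - u) y) - M (T u y) - g (T u y) * T (v - u) y) ∂μ :=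
      integral_nonneg fun y => hnonneg _ _
    rw [LinearMap.mkContinuous_apply]
    linarith

theorem integral_clarkson (hT : IsOrliczMap M μ T) (h : Nice M)
    (hc : ConvexOn ℝ (Ici 0) (fun t : ℝ => M (Real.sqrt t))) (u v : F) :
    ∫ y, M (T ((1 / 2 : ℝ) • (u + v)) y) ∂μ + ∫ y, M (T ((1 / 2 : ℝ) • (u - v)) y) ∂μ ≤
      1 / 2 * ∫ y, M (T u y) ∂μ + 1 / 2 * ∫ y, M (T v y) ∂μ := by
  have hM : ∀ w, Integrable (fun y => M (T w y)) μ := fun w =>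
    h.integrable (hT.aemeas w) (hT.finite w)
  rw [← integral_add (hM _) (hM _), ← integral_const_mul, ← integral_const_mul,
    ← integral_add ((hM _).const_mul _) ((hM _).const_mul _)]
  refine integral_mono_ae ((hM _).add (hM _)) (((hM _).const_mul _).add ((hM _).const_mul _)) ?_
  filter_upwards [hT.smul (1 / 2) (u + v), hT.smul (1 / 2) (u - v), hT.add u v, hT.sub u v]
    with y e1 e2 e3 e4
  simp only [e1, e2, e3, e4]
  exact h.clarkson hc _ _

end IsOrliczMap

/-! ### The functional A on E. -/

namespace Admissible

variable {N : ℕ} {s : ℝ} {m : ℝ → ℝ} {V : Rn N → ℝ}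

theorem isOrliczMap_diffQuot (h : Admissible N s m V) :
    IsOrliczMap (F := h.E) (orliczM m) ((volume : Measure (Rn N)).prod volume)
      (fun u => diffQuot s m (u : Rn N →ₘ[volume] ℝ)) where
  aemeas u := h.aemeasurable_diffQuot u.1
  add u v := diffQuot_add u.1 v.1
  smul k u := diffQuot_smul k u.1
  finite u := ((h.mem_carrierE_iff u.1).1 u.2).2.1
  lux_le _ := le_add_of_nonneg_right luxemburg_nonneg

theorem isOrliczMap_coe (h : Admissible N s m V) :
    IsOrliczMap (F := h.E) (orliczM m) (weighted V)
      (fun u => ((u : Rn N →ₘ[volume] ℝ) : Rn N → ℝ)) where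
  aemeas u := aemeasurable_weighted u.1
  add u v := weighted_ac.ae_eq (AEEqFun.coeFn_add u.1 v.1)
  smul k u := weighted_ac.ae_eq (AEEqFun.coeFn_smul k u.1)
  finite u := ((h.mem_carrierE_iff u.1).1 u.2).2.2
  lux_le _ := le_add_of_nonneg_left luxemburg_nonneg

/-- Moving the weight into the measure makes Ψ a modular along a linear map, so G and Ψ are covered
by the same results. -/
theorem Psi_eq (h : Admissible N s m V) (u : h.E) :
    h.Psi u = ∫ x, orliczM m ((u : Rn N →ₘ[volume] ℝ) x) ∂(weighted V) := by
  obtain ⟨V₀, hV₀, hV⟩ := h.V_bound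
  rw [weighted, integral_withDensity_eq_integral_toReal_smul
    h.V_cont.measurable.ennreal_ofReal (Eventually.of_forall fun x => ENNReal.ofReal_lt_top)]
  refine integral_congr_ae (Eventually.of_forall fun x => ?_)
  simp only [smul_eq_mul]
  rw [ENNReal.toReal_ofReal (hV₀.le.trans (hV x))]

/-- `A` is Fréchet differentiable, and its derivative is a subgradient. -/
theorem A_differentiableAt (h : Admissible N s m V)
    (hc : ConvexOn ℝ (Ici 0) (fun t : ℝ => orliczM m (Real.sqrt t))) (u : h.E) :
    DifferentiableAt ℝ h.A u ∧ ∀ v, h.A u + fderiv ℝ h.A u (v - u) ≤ h.A v := by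
  obtain ⟨L₁, hL₁, hs₁⟩ := h.isOrliczMap_diffQuot.exists_hasFDerivAt (h.youngPair hc) u
  obtain ⟨L₂, hL₂, hs₂⟩ := h.isOrliczMap_coe.exists_hasFDerivAt (h.youngPair hc) u
  have hA : HasFDerivAt h.A (L₁ + L₂) u := by
    refine (hL₁.add hL₂).congr_of_eventuallyEq (Eventually.of_forall fun w => ?_)
    simp only [A, Psi_eq, G, Pi.add_apply]
  refine ⟨hA.differentiableAt, fun v => ?_⟩
  rw [hA.fderiv, add_apply, A, A, Psi_eq, Psi_eq, G, G]
  linarith [hs₁ v, hs₂ v]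

theorem A_clarkson (h : Admissible N s m V)
    (hc : ConvexOn ℝ (Ici 0) (fun t : ℝ => orliczM m (Real.sqrt t))) (u v : h.E) :
    h.A ((1 / 2 : ℝ) • (u + v)) + h.A ((1 / 2 : ℝ) • (u - v)) ≤
      1 / 2 * h.A u + 1 / 2 * h.A v := by
  have h1 := h.isOrliczMap_diffQuot.integral_clarkson h.nice hc u v
  have h2 := h.isOrliczMap_coe.integral_clarkson h.nice hc u v
  simp only [A, Psi_eq, G]
  linarith

theorem G_nonneg (h : Admissible N s m V) (u : h.E) : 0 ≤ h.G u :=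
  integral_nonneg fun _ => h.nice.nonneg _

theorem Psi_nonneg (h : Admissible N s m V) (u : h.E) : 0 ≤ h.Psi u := by
  rw [Psi_eq]
  exact integral_nonneg fun _ => h.nice.nonneg _

/-- `A (w n) → 0` implies `w n → 0` in norm. -/
theorem tendsto_zero_of_A (h : Admissible N s m V) {w : ℕ → h.E}
    (hw : Tendsto (fun n => h.A (w n)) atTop (𝓝 0)) : Tendsto w atTop (𝓝 0) := by
  have hG : Tendsto (fun n => h.G (w n)) atTop (𝓝 0) :=
    squeeze_zero (fun n => h.G_nonneg _) (fun n => le_add_of_nonneg_right (h.Psi_nonneg _)) hw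
  have hP : Tendsto (fun n => h.Psi (w n)) atTop (𝓝 0) :=
    squeeze_zero (fun n => h.Psi_nonneg _) (fun n => le_add_of_nonneg_left (h.G_nonneg _)) hw
  have h1 := h.nice.tendsto_luxemburg (fun n => h.isOrliczMap_diffQuot.aemeas (w n))
    (fun n => h.isOrliczMap_diffQuot.finite (w n)) hG
  simp only [Psi_eq] at hP
  have h2 := h.nice.tendsto_luxemburg (fun n => h.isOrliczMap_coe.aemeas (w n))
    (fun n => h.isOrliczMap_coe.finite (w n)) hP
  rw [tendsto_zero_iff_norm_tendsto_zero]
  have h3 := h1.add h2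
  rw [add_zero] at h3
  exact h3

end Admissible

end FracOrlicz

/-! ### Strong convergence. -/

theorem lemma3p6 {N : ℕ} {s : ℝ} {m : ℝ → ℝ} {V : FracOrlicz.Rn N → ℝ}
    (h : FracOrlicz.Admissible N s m V)
    (hM₃ : ConvexOn ℝ (Set.Ici 0) (fun t : ℝ => FracOrlicz.orliczM m (Real.sqrt t)))
    (u : ℕ → h.E) (u₀ : h.E)
    (hweak : ∀ φ : StrongDual ℝ h.E,
      Filter.Tendsto (fun n => φ (u n)) Filter.atTop (nhds (φ u₀)))
    (hA : Filter.Tendsto (fun n => fderiv ℝ h.A (u n) (u n - u₀)) Filter.atTop (nhds 0)) :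
    Filter.Tendsto u Filter.atTop (nhds u₀) := by
  have hhalf : Tendsto (fun n => h.A ((1 / 2 : ℝ) • (u n - u₀))) atTop (𝓝 0) := by
    have hw := hweak (fderiv ℝ h.A u₀)
    have hb : Tendsto (fun n => 1 / 2 * fderiv ℝ h.A (u n) (u n - u₀) -
        1 / 2 * (fderiv ℝ h.A u₀ (u n) - fderiv ℝ h.A u₀ u₀)) atTop (𝓝 0) := by
      have h1 := (hA.const_mul (1 / 2)).sub
        ((hw.sub_const (fderiv ℝ h.A u₀ u₀)).const_mul (1 / 2))
      rwa [sub_self, mul_zero, sub_zero] at h1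
    refine squeeze_zero (fun n => add_nonneg (h.G_nonneg _) (h.Psi_nonneg _)) (fun n => ?_) hb
    -- The bound is ½`h1` + `h2` + `h3`: the terms in A(u_n), A(u₀) and the midpoint value all
    -- cancel.
    have h1 := (h.A_differentiableAt hM₃ (u n)).2 u₀
    have h2 := (h.A_differentiableAt hM₃ u₀).2 ((1 / 2 : ℝ) • (u n + u₀))
    have h3 := h.A_clarkson hM₃ (u n) u₀
    have e1 : fderiv ℝ h.A (u n) (u₀ - u n) = -fderiv ℝ h.A (u n) (u n - u₀) := by
      rw [← map_neg, neg_sub]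
    have e2 : (1 / 2 : ℝ) • (u n + u₀) - u₀ = (1 / 2 : ℝ) • (u n - u₀) := by module
    rw [e1] at h1
    rw [e2, map_smul, map_sub, smul_eq_mul] at h2
    linarith
  have h2 := (h.tendsto_zero_of_A hhalf).const_smul (2 : ℝ)
  simp only [smul_smul, smul_zero] at h2
  norm_num at h2
  exact tendsto_sub_nhds_zero_iff.1 h2
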